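/- Let $G$ be a simple graph on $n$ nodes and let $r$ be an integer with $1 \le r \le n-2$. Assume that $G$ is $(r+1)$-vertex connected, where "$k$-vertex connected" means that either $n=k+1$ and $G$ is the complete graph, or $n\ge k+2$ and there is no set of $k-1$ nodes whose deletion leaves a disconnected graph. Then there is a configuration $p=(p^1,\dots,p^n)$ of points in $\mathbb{R}^r$ such that: 1. $p$ is $r$-dimensional, i.e. $p^1,\dots,p^n$ affinely span $\mathbb{R}^r$; 2. $p$ is in general position in $\mathbb{R}^r$, i.e. for every $r+1$ distinct nodes the corresponding points are affinely independent; 3. the bar framework $(G,p)$ is universally rigid, i.e. there are no integer $r'$ with $1\le r'\le n-1$ and points $q^1,\dots,q^n$ affinely spanning $\mathbb{R}^{r'}$ such that $\|q^i-q^j\|=\|p^i-p^j\|$ for every edge $\{i,j\}$ of $G$ but $\|q^i-q^j\|\neq\|p^i-p^j\|$ for some pair of nodes $i,j$. -/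

import Mathlib

namespace BarFramework

/-- `G` is `k`-vertex connected: either `n = k + 1` and `G` is the complete graph, or `n ≥ k + 2`
and there is no set of `k - 1` nodes whose deletion leaves a disconnected graph. -/
def IsVertexConnected {V : Type*} [Fintype V] (G : SimpleGraph V) (k : ℕ) : Prop :=
  (Fintype.card V = k + 1 ∧ G = ⊤) ∨
    (k + 2 ≤ Fintype.card V ∧
      ¬ ∃ S : Finset V, S.card + 1 = k ∧ ¬ (G.induce ((S : Set V)ᶜ)).Connected)

/-- A configuration in `ℝ^d` is `d`-dimensional: its points affinely span `ℝ^d`. -/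
def IsFullDimensional {V : Type*} {d : ℕ} (p : V → EuclideanSpace ℝ (Fin d)) : Prop :=
  affineSpan ℝ (Set.range p) = ⊤

/-- A configuration in `ℝ^d` is in general position: every `d + 1` of its points (indexed by
`d + 1` distinct nodes) are affinely independent. -/
def InGeneralPosition {V : Type*} {d : ℕ} (p : V → EuclideanSpace ℝ (Fin d)) : Prop :=
  ∀ S : Finset V, S.card = d + 1 → AffineIndependent ℝ (fun i : S => p i)

/-- The frameworks `(G, p)` and `(G, q)`, possibly in different dimensions, are equivalent:
corresponding edges have the same length. -/
def Equivalent {V : Type*} {d e : ℕ} (G : SimpleGraph V)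
    (p : V → EuclideanSpace ℝ (Fin d)) (q : V → EuclideanSpace ℝ (Fin e)) : Prop :=
  ∀ i j : V, G.Adj i j → ‖q i - q j‖ ^ 2 = ‖p i - p j‖ ^ 2

/-- The configurations `p` and `q`, possibly in different dimensions, are congruent:
all corresponding pairwise distances agree. -/
def Congruent {V : Type*} {d e : ℕ}
    (p : V → EuclideanSpace ℝ (Fin d)) (q : V → EuclideanSpace ℝ (Fin e)) : Prop :=
  ∀ i j : V, ‖q i - q j‖ ^ 2 = ‖p i - p j‖ ^ 2

/-- `(G, p)` is universally rigid: there is no `e`-dimensional framework `(G, q)`, with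
`1 ≤ e ≤ n - 1`, that is equivalent but not congruent to `(G, p)`. -/
def UniversallyRigid {V : Type*} [Fintype V] {d : ℕ} (G : SimpleGraph V)
    (p : V → EuclideanSpace ℝ (Fin d)) : Prop :=
  ¬ ∃ e : ℕ, 1 ≤ e ∧ e + 1 ≤ Fintype.card V ∧
    ∃ q : V → EuclideanSpace ℝ (Fin e),
      IsFullDimensional q ∧ Equivalent G p q ∧ ¬ Congruent p q

end BarFramework

/-! Put `d = n - r - 1`. Connectivity says that any `d + 1` nodes induce a connected subgraph, and
this yields vectors `x v` in `ℝ^d`, any `d` of them independent, with nonadjacent nodes orthogonal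
(`exists_genPos`). Rescaled to sum to zero, their Gram matrix is a positive semidefinite stress
matrix of rank `d`; the Gale dual of `x` is the required `p` (`GenPos.exists_gale`).

Rigidity (`congruent_of_equivalent`): the stress energy of a framework is a negative multiple of a
sum of squares and sees only edge lengths. It vanishes at `p`, hence at any equivalent `q`, so the
coordinates of `q` are also relations among the `x v`. The differences of squared distances from a
fixed node then form a relation supported on its nonneighbours. These are fewer than `d`, so the
differences vanish.

The vectors `x v` come from a deformation argument. Two representations, each good for some
independence conditions, are joined by a polynomial curve; nonzero polynomials have finitely many
roots, so some point of the curve meets all the conditions. -/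

open Matrix Polynomial

namespace OrthRep

/-! ### Polynomial curves of orthogonal representations -/

section

variable {V : Type*} {d : ℕ} {R : Type*} [CommRing R]

/-- The Gram determinant of the vectors `x v`, `v ∈ T`. -/
def gramDet [DecidableEq V] (x : V → Fin d → R) (T : Finset V) : R :=
  (Matrix.of fun i j : T => x i ⬝ᵥ x j).det

/-- `x` is an orthogonal representation of `G[P]`: nonadjacent nodes get orthogonal vectors. -/
def IsOrthRep (G : SimpleGraph V) (P : Finset V) (x : V → Fin d → R) : Prop :=
  ∀ u ∈ P, ∀ v ∈ P, u ≠ v → ¬ G.Adj u v → x u ⬝ᵥ x v = 0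

lemma IsOrthRep.mono {G : SimpleGraph V} {P Q : Finset V} {x : V → Fin d → R}
    (h : IsOrthRep G P x) (hQ : Q ⊆ P) : IsOrthRep G Q x :=
  fun u hu v hv => h u (hQ hu) v (hQ hv)

lemma IsOrthRep.congr {G : SimpleGraph V} {P : Finset V} {x y : V → Fin d → R}
    (h : IsOrthRep G P x) (hxy : ∀ v ∈ P, x v = y v) : IsOrthRep G P y := by
  intro u hu v hv
  rw [← hxy u hu, ← hxy v hv]
  exact h u hu v hv

lemma map_dotProduct' {S : Type*} [CommRing S] (f : R →+* S) (u v : Fin d → R) :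
    f (u ⬝ᵥ v) = (fun i => f (u i)) ⬝ᵥ (fun i => f (v i)) := by
  simp [dotProduct, map_sum]

lemma IsOrthRep.map {S : Type*} [CommRing S] {G : SimpleGraph V} {P : Finset V}
    {x : V → Fin d → R} (h : IsOrthRep G P x) (f : R →+* S) :
    IsOrthRep G P (fun v i => f (x v i)) := by
  intro u hu v hv huv hadj
  rw [← map_dotProduct', h u hu v hv huv hadj, map_zero]

/-- Two orthogonal representations of `G[P]` lie, up to scaling the vectors, on a common
polynomial curve of orthogonal representations. -/
def Joined (G : SimpleGraph V) (P : Finset V) (y z : V → Fin d → ℝ) : Prop :=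
  ∃ γ : V → Fin d → ℝ[X], IsOrthRep G P γ ∧
    (∃ a : V → ℝ, ∀ v ∈ P, a v ≠ 0 ∧ (fun i => evalRingHom 0 (γ v i)) = a v • y v) ∧
    (∃ a : V → ℝ, ∀ v ∈ P, a v ≠ 0 ∧ (fun i => evalRingHom 1 (γ v i)) = a v • z v)

lemma joined_empty (G : SimpleGraph V) (y z : V → Fin d → ℝ) : Joined G ∅ y z :=
  ⟨0, by simp [IsOrthRep], by simp, by simp⟩

variable [DecidableEq V]

lemma gramDet_map {S : Type*} [CommRing S] (f : R →+* S) (x : V → Fin d → R) (T : Finset V) :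
    gramDet (fun v i => f (x v i)) T = f (gramDet x T) := by
  unfold gramDet
  rw [RingHom.map_det]
  congr 1
  ext i j
  simp [map_dotProduct']

lemma gramDet_congr {x y : V → Fin d → R} {T : Finset V} (h : ∀ v ∈ T, x v = y v) :
    gramDet x T = gramDet y T := by
  unfold gramDet
  congr 1
  ext i j
  simp [h i i.2, h j j.2]

lemma gramDet_ne_zero_iff {x : V → Fin d → ℝ} {T : Finset V} :
    gramDet x T ≠ 0 ↔ LinearIndependent ℝ (fun i : T => x i) := by
  have h1 : (Matrix.of fun i j : T => x i ⬝ᵥ x j) =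
      gram ℝ (fun i : T => (WithLp.linearEquiv 2 ℝ (Fin d → ℝ)).symm (x i)) := by
    ext i j
    simp [gram, EuclideanSpace.inner_eq_star_dotProduct, dotProduct_comm]
  unfold gramDet
  rw [h1, ← (posSemidef_gram ℝ _).posDef_iff_det_ne_zero, posDef_gram_iff_linearIndependent]
  exact LinearMap.linearIndependent_iff _ (LinearEquiv.ker _)

lemma gramDet_smul_ne_zero {x : V → Fin d → ℝ} {T : Finset V} {a : V → ℝ}
    (ha : ∀ v ∈ T, a v ≠ 0) (h : gramDet x T ≠ 0) : gramDet (fun v => a v • x v) T ≠ 0 := by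
  rw [gramDet_ne_zero_iff] at h ⊢
  exact h.units_smul (fun i => Units.mk0 (a i) (ha i i.2))

/-- Cramer-type orthogonal projection: a vector orthogonal to all `γ w`, `w ∈ N`, which is a
multiple of `u` wherever `u` is itself orthogonal to them. -/
lemma exists_orthogonal (γ : V → Fin d → R) (N : Finset V) (u : Fin d → R) :
    ∃ z : Fin d → R, (∀ w ∈ N, γ w ⬝ᵥ z = 0) ∧
      ∀ f : R →+* ℝ, (∀ w ∈ N, (fun i => f (γ w i)) ⬝ᵥ (fun i => f (u i)) = 0) →
        (fun i => f (z i)) = f (gramDet γ N) • (fun i => f (u i)) := by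
  set M : Matrix N N R := Matrix.of fun i j : N => γ i ⬝ᵥ γ j with hM
  set b : N → R := fun w => γ w ⬝ᵥ u with hb
  -- The orthogonal projection of `u` cleared of its denominator `M.det`, so that it makes sense
  -- over `ℝ[X]`.
  refine ⟨M.det • u - ∑ w : N, (M.adjugate *ᵥ b) w • γ w, ?_, ?_⟩
  · intro w hw
    have h1 : (M *ᵥ (M.adjugate *ᵥ b)) ⟨w, hw⟩ = M.det * b ⟨w, hw⟩ := by
      rw [mulVec_mulVec, mul_adjugate, smul_mulVec, one_mulVec]
      simp
    have h2 : (M *ᵥ (M.adjugate *ᵥ b)) ⟨w, hw⟩ =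
        ∑ w' : N, (M.adjugate *ᵥ b) w' * (γ w ⬝ᵥ γ w') := by
      rw [mulVec, dotProduct]
      exact Finset.sum_congr rfl fun w' _ => by simp [hM, mul_comm]
    rw [dotProduct_sub, dotProduct_smul, dotProduct_sum]
    simp only [dotProduct_smul, smul_eq_mul]
    rw [← h2, h1, sub_self]
  · intro f hf
    have hb0 : ∀ w, f (b w) = 0 := fun w => by rw [hb, map_dotProduct']; exact hf w w.2
    have h0 : ∀ w, f ((M.adjugate *ᵥ b) w) = 0 := fun w => by
      simp [mulVec, dotProduct, hb0]
    ext i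
    simp only [Pi.sub_apply, Pi.smul_apply, Finset.sum_apply, smul_eq_mul, map_sub, map_mul, map_sum,
      h0, zero_mul, Finset.sum_const_zero, sub_zero]
    rfl

/-- The nonneighbours of `v` in `P`. -/
noncomputable def nonNbrs (G : SimpleGraph V) (P : Finset V) (v : V) : Finset V := by
  classical exact P.filter fun w => w ≠ v ∧ ¬ G.Adj v w

lemma mem_nonNbrs {G : SimpleGraph V} {P : Finset V} {v w : V} :
    w ∈ nonNbrs G P v ↔ w ∈ P ∧ w ≠ v ∧ ¬ G.Adj v w := by
  simp [nonNbrs]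

lemma isOrthRep_insert {G : SimpleGraph V} {P : Finset V} {v : V} {x : V → Fin d → R}
    (h : IsOrthRep G P x) (hv : ∀ w ∈ nonNbrs G P v, x w ⬝ᵥ x v = 0) :
    IsOrthRep G (insert v P) x := by
  intro a ha b hb hab hadj
  rcases Finset.mem_insert.1 ha with rfl | ha' <;>
    rcases Finset.mem_insert.1 hb with rfl | hb'
  · exact absurd rfl hab
  · rw [dotProduct_comm]
    exact hv b (mem_nonNbrs.2 ⟨hb', hab.symm, hadj⟩)
  · exact hv a (mem_nonNbrs.2 ⟨ha', hab, fun h => hadj h.symm⟩)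
  · exact h a ha' b hb' hab hadj

/-- The segment from `y v` to `z v` is projected off the curves of the nonneighbours of `v`. At the
ends this only rescales, by a Gram determinant that is nonzero by assumption. -/
lemma Joined.insert {G : SimpleGraph V} {P : Finset V} {v : V} {y z : V → Fin d → ℝ}
    (h : Joined G P y z) (hv : v ∉ P) (hy : IsOrthRep G (insert v P) y)
    (hz : IsOrthRep G (insert v P) z) (hyN : gramDet y (nonNbrs G P v) ≠ 0)
    (hzN : gramDet z (nonNbrs G P v) ≠ 0) : Joined G (insert v P) y z := by
  obtain ⟨γ, hγ, ⟨a, ha⟩, ⟨b, hb⟩⟩ := h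
  have hNP : ∀ w ∈ nonNbrs G P v, w ∈ P := fun w hw => (mem_nonNbrs.1 hw).1
  obtain ⟨x, hx1, hx2⟩ := exists_orthogonal γ (nonNbrs G P v)
    (fun i => (1 - X) * C (y v i) + X * C (z v i))
  have hne : ∀ w ∈ P, w ≠ v := fun w hw h => hv (h ▸ hw)
  have main : ∀ (t : ℝ) (y' : V → Fin d → ℝ) (a : V → ℝ),
      (∀ w ∈ P, a w ≠ 0 ∧ (fun i => evalRingHom t (γ w i)) = a w • y' w) →
      IsOrthRep G (Insert.insert v P) y' → gramDet y' (nonNbrs G P v) ≠ 0 →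
      (∀ i, evalRingHom t ((1 - X) * C (y v i) + X * C (z v i)) = y' v i) →
      ∃ a : V → ℝ, ∀ w ∈ Insert.insert v P,
        a w ≠ 0 ∧ (fun i => evalRingHom t (Function.update γ v x w i)) = a w • y' w := by
    intro t y' a ha hy hN hu
    refine ⟨Function.update a v (evalRingHom t (gramDet γ (nonNbrs G P v))), ?_⟩
    intro w hw
    rcases Finset.mem_insert.1 hw with rfl | hw
    · simp only [Function.update_self]
      refine ⟨?_, ?_⟩
      · rw [← gramDet_map, gramDet_congr (y := fun v => a v • y' v) fun v hv => (ha v (hNP v hv)).2]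
        exact gramDet_smul_ne_zero (fun v hv => (ha v (hNP v hv)).1) hN
      · rw [hx2 (evalRingHom t)]
        · congr 1
          ext i
          exact hu i
        · intro w' hw'
          rw [(ha w' (hNP w' hw')).2, funext hu, smul_dotProduct,
            hy w' (Finset.mem_insert_of_mem (hNP w' hw')) w (Finset.mem_insert_self _ _)
              (mem_nonNbrs.1 hw').2.1 (fun h => (mem_nonNbrs.1 hw').2.2 h.symm), smul_zero]
    · simp only [Function.update_of_ne (hne w hw)]
      exact ha w hw
  refine ⟨Function.update γ v x, ?_, main 0 y a ha hy hyN (by simp), main 1 z b hb hz hzN (by simp)⟩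
  apply isOrthRep_insert
  · exact hγ.congr fun w hw => by rw [Function.update_of_ne (hne w hw)]
  · intro w hw
    rw [Function.update_of_ne (hne w (hNP w hw)), Function.update_self]
    exact hx1 w hw

/-- Independence conditions met at two joined representations can be met simultaneously. -/
lemma Joined.exists_gramDet_ne_zero {G : SimpleGraph V} {P : Finset V} {y z : V → Fin d → ℝ}
    (h : Joined G P y z) :
    ∃ x : V → Fin d → ℝ, IsOrthRep G P x ∧
      ∀ T ⊆ P, gramDet y T ≠ 0 ∨ gramDet z T ≠ 0 → gramDet x T ≠ 0 := by
  classical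
  obtain ⟨γ, hγ, ⟨a, ha⟩, ⟨b, hb⟩⟩ := h
  have key : ∀ (t : ℝ) (y : V → Fin d → ℝ) (a : V → ℝ),
      (∀ v ∈ P, a v ≠ 0 ∧ (fun i => evalRingHom t (γ v i)) = a v • y v) →
      ∀ T ⊆ P, gramDet y T ≠ 0 → gramDet γ T ≠ 0 := by
    intro t y a ha T hT hy h0
    have h1 := gramDet_map (evalRingHom t) γ T
    rw [h0, map_zero, gramDet_congr (y := fun v => a v • y v) fun v hv => (ha v (hT hv)).2] at h1
    exact gramDet_smul_ne_zero (fun v hv => (ha v (hT hv)).1) hy h1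
  set F := P.powerset.filter fun T => gramDet γ T ≠ 0 with hF
  have hprod : ∏ T ∈ F, gramDet γ T ≠ 0 :=
    Finset.prod_ne_zero_iff.2 fun T hT => (Finset.mem_filter.1 hT).2
  obtain ⟨t, ht⟩ : ∃ t : ℝ, (∏ T ∈ F, gramDet γ T).eval t ≠ 0 := by
    by_contra! hcon
    exact hprod (Polynomial.funext fun t => by simp [hcon t])
  refine ⟨fun v i => evalRingHom t (γ v i), hγ.map _, fun T hT hyz => ?_⟩
  rw [gramDet_map]
  rw [eval_prod, Finset.prod_ne_zero_iff] at ht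
  apply ht
  rw [hF, Finset.mem_filter, Finset.mem_powerset]
  exact ⟨hT, hyz.elim (key 0 y a ha T hT) (key 1 z b hb T hT)⟩

end

/-! ### Existence of general position orthogonal representations -/

section

variable {V : Type*} {d : ℕ}

/-- Every set of at least `d + 1` nodes induces a connected subgraph. -/
def LargeSetsConnected (G : SimpleGraph V) (d : ℕ) : Prop :=
  ∀ P : Finset V, d + 1 ≤ P.card → ∀ S ⊆ P, S.Nonempty → S ≠ P →
    ∃ a ∈ S, ∃ b ∈ P, b ∉ S ∧ G.Adj a b

variable [DecidableEq V]

/-- Any at most `d` of the vectors `x v ∈ ℝ^d`, `v ∈ P`, are linearly independent. -/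
def GenPos (P : Finset V) (x : V → Fin d → ℝ) : Prop :=
  ∀ T ⊆ P, T.card ≤ d → gramDet x T ≠ 0

lemma GenPos.mono {P Q : Finset V} {x : V → Fin d → ℝ} (h : GenPos P x) (hQ : Q ⊆ P) :
    GenPos Q x :=
  fun T hT => h T (hT.trans hQ)

lemma GenPos.congr {P : Finset V} {x y : V → Fin d → ℝ} (h : GenPos P x)
    (hxy : ∀ v ∈ P, x v = y v) : GenPos P y := by
  intro T hT hTd
  rw [← gramDet_congr fun v hv => hxy v (hT hv)]
  exact h T hT hTd

/-- Otherwise `v` would be isolated among `d + 1` nodes. -/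
lemma card_nonNbrs_lt {G : SimpleGraph V} (hG : LargeSetsConnected G d) (hd : 0 < d)
    (P : Finset V) (v : V) : (nonNbrs G P v).card < d := by
  by_contra! hcon
  obtain ⟨T, hT, hTd⟩ := Finset.exists_subset_card_eq hcon
  have hv : v ∉ T := fun h => (mem_nonNbrs.1 (hT h)).2.1 rfl
  obtain ⟨a, ha, b, hb, hba, hab⟩ := hG (insert v T) (by rw [Finset.card_insert_of_notMem hv, hTd])
    {v} (by simp) (by simp) (fun h => by
      have := congrArg Finset.card h
      rw [Finset.card_insert_of_notMem hv] at this
      simp at this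
      subst this
      simp at hTd
      omega)
  rw [Finset.mem_singleton] at ha hba
  subst ha
  exact (mem_nonNbrs.1 (hT ((Finset.mem_insert.1 hb).resolve_left hba))).2.2 hab

lemma gramDet_nonNbrs_ne_zero {G : SimpleGraph V} (hG : LargeSetsConnected G d) (hd : 0 < d)
    {P Q : Finset V} {v : V} {x : V → Fin d → ℝ} (hx : GenPos P x) (h : nonNbrs G Q v ⊆ P) :
    gramDet x (nonNbrs G Q v) ≠ 0 :=
  hx _ h (card_nonNbrs_lt hG hd Q v).le

lemma nonNbrs_subset (G : SimpleGraph V) (P : Finset V) (v : V) : nonNbrs G P v ⊆ P :=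
  fun _ hw => (mem_nonNbrs.1 hw).1

lemma joined_of_genPos {G : SimpleGraph V} (hG : LargeSetsConnected G d) (hd : 0 < d)
    {y z : V → Fin d → ℝ} (P : Finset V) : IsOrthRep G P y → IsOrthRep G P z → GenPos P y →
      GenPos P z → Joined G P y z := by
  induction P using Finset.induction_on with
  | empty => exact fun _ _ _ _ => joined_empty G y z
  | insert v P hv ih =>
    intro hy hz hyP hzP
    have hs := Finset.subset_insert v P
    exact (ih (hy.mono hs) (hz.mono hs) (hyP.mono hs) (hzP.mono hs)).insert hv hy hz
      (gramDet_nonNbrs_ne_zero hG hd (hyP.mono hs) (nonNbrs_subset G P v))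
      (gramDet_nonNbrs_ne_zero hG hd (hzP.mono hs) (nonNbrs_subset G P v))

/-- With `a` inserted last, its own vectors enter no independence condition and may even be zero. -/
lemma joined_of_genPos_erase {G : SimpleGraph V} (hG : LargeSetsConnected G d) (hd : 0 < d)
    {y z : V → Fin d → ℝ} {P : Finset V} {a : V} (ha : a ∈ P) (hy : IsOrthRep G P y)
    (hz : IsOrthRep G P z) (hyP : GenPos (P.erase a) y) (hzP : GenPos (P.erase a) z) :
    Joined G P y z := by
  have hs := Finset.erase_subset a P
  have h := joined_of_genPos hG hd _ (hy.mono hs) (hz.mono hs) hyP hzP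
  rw [← Finset.insert_erase ha] at hy hz ⊢
  exact h.insert (Finset.notMem_erase a P) hy hz
    (gramDet_nonNbrs_ne_zero hG hd hyP (nonNbrs_subset G _ a))
    (gramDet_nonNbrs_ne_zero hG hd hzP (nonNbrs_subset G _ a))

/-- Orthogonal representations of `G[P]` that are in general position after deleting any one node
of `S` exist. -/
def HasRepOff (G : SimpleGraph V) (d : ℕ) (P S : Finset V) : Prop :=
  ∃ x : V → Fin d → ℝ, IsOrthRep G P x ∧ ∀ b ∈ S, GenPos (P.erase b) x

lemma HasRepOff.union {G : SimpleGraph V} (hG : LargeSetsConnected G d) (hd : 0 < d)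
    {P S S' : Finset V} {a : V} (haP : a ∈ P) (ha : a ∈ S) (ha' : a ∈ S')
    (h : HasRepOff G d P S) (h' : HasRepOff G d P S') : HasRepOff G d P (S ∪ S') := by
  obtain ⟨y, hy, hyS⟩ := h
  obtain ⟨z, hz, hzS⟩ := h'
  obtain ⟨x, hx, hxT⟩ := (joined_of_genPos_erase hG hd haP hy hz (hyS a ha)
    (hzS a ha')).exists_gramDet_ne_zero
  refine ⟨x, hx, fun b hb T hT hTd => hxT T (hT.trans (Finset.erase_subset b P)) ?_⟩
  rcases Finset.mem_union.1 hb with hb | hb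
  · exact Or.inl (hyS b hb T hT hTd)
  · exact Or.inr (hzS b hb T hT hTd)

/-- Extending a general position representation of `G[P - a]` by the zero vector. -/
lemma exists_isOrthRep_update_zero {G : SimpleGraph V} {P : Finset V} {a : V} (ha : a ∈ P)
    {x : V → Fin d → ℝ} (hx : IsOrthRep G (P.erase a) x) (hxP : GenPos (P.erase a) x) :
    ∃ y : V → Fin d → ℝ, IsOrthRep G P y ∧ GenPos (P.erase a) y := by
  have h : ∀ v ∈ P.erase a, x v = Function.update x a 0 v := fun v hv => by
    rw [Function.update_of_ne (Finset.ne_of_mem_erase hv)]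
  refine ⟨Function.update x a 0, ?_, hxP.congr h⟩
  rw [← Finset.insert_erase ha]
  exact isOrthRep_insert (hx.congr h) (by simp)

/-- A representation good off `a` and one good off `b` are joined by inserting `b`, then `a`.
Adjacency keeps `b` out of the nonneighbours of `a`, which therefore lie where both are in general
position. -/
lemma hasRepOff_pair {G : SimpleGraph V} (hG : LargeSetsConnected G d) (hd : 0 < d)
    {P : Finset V} {a b : V} (ha : a ∈ P) (hb : b ∈ P) (hab : G.Adj a b)
    (h : ∀ c ∈ P, ∃ x : V → Fin d → ℝ, IsOrthRep G (P.erase c) x ∧ GenPos (P.erase c) x) :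
    HasRepOff G d P {a, b} := by
  obtain ⟨y, hy, hyP⟩ : ∃ y : V → Fin d → ℝ, IsOrthRep G P y ∧ GenPos (P.erase a) y := by
    obtain ⟨x, hx, hxP⟩ := h a ha
    exact exists_isOrthRep_update_zero ha hx hxP
  obtain ⟨z, hz, hzP⟩ : ∃ y : V → Fin d → ℝ, IsOrthRep G P y ∧ GenPos (P.erase b) y := by
    obtain ⟨x, hx, hxP⟩ := h b hb
    exact exists_isOrthRep_update_zero hb hx hxP
  set Q := (P.erase a).erase b with hQ
  have hQa : Q ⊆ P.erase a := Finset.erase_subset _ _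
  have hQb : Q ⊆ P.erase b := Finset.erase_subset_erase _ (Finset.erase_subset _ _)
  have hba : b ∈ P.erase a := Finset.mem_erase.2 ⟨hab.ne', hb⟩
  have hsub : P.erase a ⊆ P := Finset.erase_subset _ _
  have h1 : Joined G (P.erase a) y z :=
    joined_of_genPos_erase hG hd hba (hy.mono hsub) (hz.mono hsub) (hyP.mono hQa) (hzP.mono hQb)
  have hN : nonNbrs G (P.erase a) a ⊆ Q := by
    intro w hw
    obtain ⟨hw1, hw2, hw3⟩ := mem_nonNbrs.1 hw
    exact Finset.mem_erase.2 ⟨fun h => hw3 (h ▸ hab), hw1⟩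
  have h2 : Joined G P y z := by
    rw [← Finset.insert_erase ha] at hy hz ⊢
    exact h1.insert (Finset.notMem_erase a P) hy hz
      (gramDet_nonNbrs_ne_zero hG hd (hyP.mono hQa) hN)
      (gramDet_nonNbrs_ne_zero hG hd (hzP.mono hQb) hN)
  obtain ⟨x, hx, hxT⟩ := h2.exists_gramDet_ne_zero
  refine ⟨x, hx, fun c hc T hT hTd => hxT T (hT.trans (Finset.erase_subset c P)) ?_⟩
  rcases Finset.mem_insert.1 hc with rfl | hc
  · exact Or.inl (hyP T hT hTd)
  · rw [Finset.mem_singleton] at hc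
    subst hc
    exact Or.inr (hzP T hT hTd)

/-- **Lovász–Saks–Schrijver**: general position orthogonal representations exist. -/
theorem exists_genPos {G : SimpleGraph V} (hG : LargeSetsConnected G d) (hd : 0 < d)
    (P : Finset V) : ∃ x : V → Fin d → ℝ, IsOrthRep G P x ∧ GenPos P x := by
  induction P using Finset.strongInduction with
  | H P ih =>
  rcases le_or_gt P.card d with hPd | hPd
  · obtain ⟨e⟩ : Nonempty (P ↪ Fin d) :=
      Function.Embedding.nonempty_of_card_le (by simpa using hPd)
    set x : V → Fin d → ℝ := fun v => if h : v ∈ P then Pi.single (e ⟨v, h⟩) 1 else 0 with hx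
    have hxe : ∀ v (h : v ∈ P), x v = Pi.single (e ⟨v, h⟩) 1 := fun v h => by simp [hx, h]
    refine ⟨x, fun u hu v hv huv _ => ?_, fun T hT _ => ?_⟩
    · rw [hxe u hu, hxe v hv, single_dotProduct, one_mul, Pi.single_eq_of_ne]
      exact fun h => huv (congrArg Subtype.val (e.injective h))
    · rw [gramDet_ne_zero_iff]
      have h1 := (Pi.linearIndependent_single_one (Fin d) ℝ).comp
        (fun i : T => e ⟨i, hT i.2⟩)
        (fun i j hij => Subtype.ext (Subtype.mk.inj (e.injective hij)))
      convert h1 using 2 with i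
      exact hxe i (hT i.2)
  · have hers : ∀ c ∈ P, ∃ x : V → Fin d → ℝ,
        IsOrthRep G (P.erase c) x ∧ GenPos (P.erase c) x :=
      fun c hc => ih _ (Finset.erase_ssubset hc)
    classical
    obtain ⟨a, ha⟩ : P.Nonempty := Finset.card_pos.1 (by omega)
    have hstart : HasRepOff G d P {a} := by
      obtain ⟨x, hx, hxP⟩ := hers a ha
      obtain ⟨y, hy, hyP⟩ := exists_isOrthRep_update_zero ha hx hxP
      exact ⟨y, hy, by simpa using hyP⟩
    obtain ⟨S, hS, hmax⟩ := Finset.exists_max_image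
      (P.powerset.filter fun S => S.Nonempty ∧ HasRepOff G d P S) Finset.card
      ⟨{a}, by simp [ha, hstart]⟩
    simp only [Finset.mem_filter, Finset.mem_powerset] at hS hmax
    obtain ⟨hSP, hSne, hSrep⟩ := hS
    -- By connectivity an edge leaves any proper `S`; merging with the representation for that edge
    -- would enlarge `S`.
    have hSeq : S = P := by
      by_contra hne
      obtain ⟨u, hu, v, hv, hvS, huv⟩ := hG P hPd S hSP hSne hne
      have h1 := hSrep.union hG hd (hSP hu) hu (Finset.mem_insert_self u {v})
        (hasRepOff_pair hG hd (hSP hu) hv huv hers)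
      have h2 := hmax _ ⟨Finset.union_subset hSP (by
        intro w hw
        rcases Finset.mem_insert.1 hw with rfl | hw
        · exact hSP hu
        · rwa [Finset.mem_singleton.1 hw]), hSne.mono Finset.subset_union_left, h1⟩
      have h3 : S ⊂ S ∪ {u, v} :=
        (Finset.ssubset_iff_of_subset Finset.subset_union_left).2 ⟨v, by simp, hvS⟩
      exact absurd (Finset.card_lt_card h3) (by omega)
    subst hSeq
    obtain ⟨x, hx, hxS⟩ := hSrep
    refine ⟨x, hx, fun T hT hTd => ?_⟩
    -- As `T` has at most `d` of the more than `d` nodes of `P`, it avoids some `b`, and general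
    -- position off `b` covers it.
    obtain ⟨b, hb, hbT⟩ := Finset.exists_mem_notMem_of_card_lt_card (lt_of_le_of_lt hTd hPd)
    exact hxS b hb T (fun w hw => Finset.mem_erase.2 ⟨fun h => hbT (h ▸ hw), hT hw⟩) hTd

end

/-! ### From vertex connectivity to connected large sets -/

section
lemma largeSetsConnected_of_isVertexConnected {V : Type*} [Fintype V] {G : SimpleGraph V}
    {d r : ℕ} (hd : d + r + 1 = Fintype.card V)
    (hG : BarFramework.IsVertexConnected G (r + 1)) : LargeSetsConnected G d := by
  classical
  intro P hP S hSP hS hne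
  obtain ⟨a, ha⟩ := hS
  obtain ⟨b, hb, hbS⟩ := Finset.exists_of_ssubset (hSP.ssubset_of_ne hne)
  have hab : a ≠ b := fun h => hbS (h ▸ ha)
  rcases hG with ⟨-, rfl⟩ | ⟨hcard, hcut⟩
  · exact ⟨a, ha, b, hb, hbS, hab⟩
  -- `P` is shrunk to exactly `d + 1` nodes, so that the deleted complement has `r` nodes.
  obtain ⟨Q, hQ1, hQ2, hQ3⟩ := Finset.exists_subsuperset_card_eq (s := {a, b}) (t := P) (n := d + 1)
    (by
      intro w hw
      rcases Finset.mem_insert.1 hw with rfl | hw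
      · exact hSP ha
      · rwa [Finset.mem_singleton.1 hw])
    (by rw [Finset.card_pair hab]; omega) hP
  by_contra! hcon
  apply hcut
  refine ⟨Qᶜ, by rw [Finset.card_compl, hQ3]; omega, fun hconn => ?_⟩
  have hQ : ((Qᶜ : Finset V) : Set V)ᶜ = (Q : Set V) := by simp
  rw [hQ] at hconn
  have hclosed : ∀ u v : (Q : Set V), (G.induce (Q : Set V)).Reachable u v →
      (u : V) ∈ S → (v : V) ∈ S := by
    rintro u v ⟨w⟩
    induction w with
    | nil => exact id
    | cons hadj _ ih =>
      intro hu
      apply ih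
      by_contra hv
      exact hcon _ hu _ (hQ2 (Subtype.coe_prop _)) hv hadj
  exact hbS (hclosed ⟨a, hQ1 (by simp)⟩ ⟨b, hQ1 (by simp)⟩ (hconn.preconnected _ _) ha)
end

/-! ### Linear relations and Gale duality -/

section

variable {V : Type*} [Fintype V] [DecidableEq V] {d r : ℕ}

lemma GenPos.span_eq_top {x : V → Fin d → ℝ} (hx : GenPos Finset.univ x)
    (hd : d ≤ Fintype.card V) : Submodule.span ℝ (Set.range x) = ⊤ := by
  obtain ⟨T, -, hT⟩ := Finset.exists_subset_card_eq (s := (Finset.univ : Finset V)) hd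
  have h := gramDet_ne_zero_iff.1 (hx T (Finset.subset_univ T) hT.le)
  have h1 := h.span_eq_top_of_card_eq_finrank' (by simp [hT])
  rw [eq_top_iff, ← h1]
  apply Submodule.span_mono
  rintro _ ⟨i, rfl⟩
  exact ⟨i, rfl⟩

lemma GenPos.eq_zero_of_sum_smul_eq_zero {x : V → Fin d → ℝ} (hx : GenPos Finset.univ x)
    {c : V → ℝ} (hc : ∑ v, c v • x v = 0) {S : Finset V} (hS : Fintype.card V ≤ S.card + d)
    (hcS : ∀ v ∈ S, c v = 0) : c = 0 := by
  have h := gramDet_ne_zero_iff.1 (hx Sᶜ (Finset.subset_univ _)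
    (by rw [Finset.card_compl]; omega))
  have h1 : ∑ i : (Sᶜ : Finset V), c i • x i = 0 := by
    rw [Finset.sum_coe_sort Sᶜ (fun i => c i • x i), ← hc]
    refine Finset.sum_subset (Finset.subset_univ _) fun v _ hv => ?_
    rw [hcS v (by simpa using hv), zero_smul]
  have h2 := Fintype.linearIndependent_iff.1 h (fun i => c i) h1
  ext v
  by_cases hv : v ∈ S
  · exact hcS v hv
  · exact h2 ⟨v, by simpa using hv⟩

/-- The linear relations among vectors in general position can be prescribed on any
`card V - d` of the nodes. -/
lemma GenPos.exists_relation {x : V → Fin d → ℝ} (hx : GenPos Finset.univ x)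
    {S : Finset V} (hS : S.card + d = Fintype.card V) (g : V → ℝ) :
    ∃ c : V → ℝ, ∑ v, c v • x v = 0 ∧ ∀ v ∈ S, c v = g v := by
  set K := LinearMap.ker (Fintype.linearCombination ℝ x) with hK
  have hker : ∀ c : V → ℝ, c ∈ K ↔ ∑ v, c v • x v = 0 := fun c => by
    rw [hK, LinearMap.mem_ker, Fintype.linearCombination_apply]
  have hrank := LinearMap.finrank_range_add_finrank_ker (Fintype.linearCombination ℝ x)
  rw [Fintype.range_linearCombination, hx.span_eq_top (by omega), finrank_top,
    Module.finrank_fin_fun, Module.finrank_fintype_fun_eq_card, ← hK] at hrank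
  let ρ : K →ₗ[ℝ] (S → ℝ) := (LinearMap.funLeft ℝ ℝ (Subtype.val : S → V)).comp K.subtype
  have hinj : Function.Injective ρ := by
    rw [← LinearMap.ker_eq_bot, LinearMap.ker_eq_bot']
    rintro ⟨c, hc⟩ h0
    exact Subtype.ext (hx.eq_zero_of_sum_smul_eq_zero ((hker c).1 hc) hS.ge
      fun v hv => congrFun h0 ⟨v, hv⟩)
  have hsurj := (LinearMap.injective_iff_surjective_of_finrank_eq_finrank
    (by rw [Module.finrank_fintype_fun_eq_card, Fintype.card_coe]; omega)).1 hinj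
  obtain ⟨⟨c, hc⟩, hcg⟩ := hsurj fun i => g i
  exact ⟨c, (hker c).1 hc, fun v hv => congrFun hcg ⟨v, hv⟩⟩

/-- Rescaling makes the vectors of a general position representation sum to zero. -/
lemma exists_genPos_sum_eq_zero {G : SimpleGraph V} (hG : LargeSetsConnected G d) (hd : 0 < d)
    (hdV : d < Fintype.card V) : ∃ x : V → Fin d → ℝ, IsOrthRep G Finset.univ x ∧
      GenPos Finset.univ x ∧ ∑ v, x v = 0 := by
  obtain ⟨x, hx, hxP⟩ := exists_genPos hG hd Finset.univ
  -- No coordinate vanishes identically on the space of relations, so some relation has all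
  -- coefficients nonzero.
  obtain ⟨⟨c, hc⟩, hc0⟩ := Module.Dual.exists_forall_ne_zero_of_forall_exists
    (fun v : V => (LinearMap.proj v : (V → ℝ) →ₗ[ℝ] ℝ).comp
      (LinearMap.ker (Fintype.linearCombination ℝ x)).subtype) (by
    intro v
    obtain ⟨S, hvS, -, hS⟩ := Finset.exists_subsuperset_card_eq (n := Fintype.card V - d)
      (Finset.subset_univ {v}) (by simp; omega) (by simp)
    obtain ⟨c, hc, hcS⟩ := hxP.exists_relation (S := S) (by omega) 1
    refine ⟨⟨c, by rwa [LinearMap.mem_ker, Fintype.linearCombination_apply]⟩, ?_⟩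
    simp [hcS v (hvS (by simp))])
  rw [LinearMap.mem_ker, Fintype.linearCombination_apply] at hc
  refine ⟨fun v => c v • x v, ?_, ?_, hc⟩
  · intro u hu v hv huv hadj
    rw [smul_dotProduct, dotProduct_smul, hx u hu v hv huv hadj, smul_zero, smul_zero]
  · intro T hT hTd
    exact gramDet_smul_ne_zero (fun v _ => hc0 v) (hxP T hT hTd)

/-- Gale duality: a configuration whose coordinate functions are relations among the `x v`. -/
lemma GenPos.exists_gale {x : V → Fin d → ℝ} (hx : GenPos Finset.univ x)
    (hsum : ∑ v, x v = 0) (hd : d + r + 1 = Fintype.card V) :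
    ∃ p : V → EuclideanSpace ℝ (Fin r), (∀ k, ∑ v, p v k • x v = 0) ∧
      BarFramework.IsFullDimensional p ∧ BarFramework.InGeneralPosition p := by
  obtain ⟨S, -, hS⟩ := Finset.exists_subset_card_eq (s := (Finset.univ : Finset V))
    (n := r + 1) (by rw [Finset.card_univ]; omega)
  let e : Fin (r + 1) ≃ S := (Fintype.equivFinOfCardEq (by simpa using hS)).symm
  have he : ∀ i j, (e i : V) = e j ↔ i = j := fun i j => by simp
  -- This places `e 0` at the origin and the other nodes of `S` at the standard basis vectors.
  choose P hP1 hP2 using fun k : Fin r => hx.exists_relation (S := S) (by omega)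
    (fun v => if v = e k.succ then 1 else 0)
  set p : V → EuclideanSpace ℝ (Fin r) := fun v => WithLp.toLp 2 fun k => P k v with hp
  -- Constants are relations because `∑ v, x v = 0`; so the relation `c` and its affine interpolant
  -- on `S` agree everywhere.
  have haff : ∀ c : V → ℝ, ∑ v, c v • x v = 0 → ∃ (α : ℝ) (β : Fin r → ℝ),
      ∀ v, c v = α + ∑ k, β k * p v k := by
    intro c hc
    refine ⟨c (e 0), fun k => c (e k.succ) - c (e 0), fun v => ?_⟩
    have h := hx.eq_zero_of_sum_smul_eq_zero (S := S)
      (c := fun v => c v - (c (e 0) + ∑ k, (c (e k.succ) - c (e 0)) * P k v)) ?_ (by omega) ?_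
    · exact sub_eq_zero.1 (congrFun h v)
    · simp only [sub_smul, add_smul, Finset.sum_sub_distrib, Finset.sum_add_distrib, hc,
        ← Finset.smul_sum, hsum, Finset.sum_smul, mul_smul, smul_zero]
      rw [Finset.sum_comm]
      simp only [← Finset.smul_sum, hP1, smul_zero, zero_add, zero_sub, neg_eq_zero,
        Finset.sum_const_zero]
      rw [Finset.sum_comm]
      simp [hP1]
    · intro w hw
      obtain ⟨i, hi⟩ := e.surjective ⟨w, hw⟩
      have hi' : w = e i := by rw [hi]
      subst hi'
      have h1 : ∀ k, P k (e i) = if i = k.succ then 1 else 0 := fun k => by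
        rw [hP2 k _ (e i).2]
        simp only [he]
      simp only [h1]
      refine Fin.cases ?_ (fun j => ?_) i
      · simp [(Fin.succ_ne_zero _).symm]
      · simp [Fin.succ_inj]
  have hgen : BarFramework.InGeneralPosition p := by
    intro T hT
    rw [affineIndependent_iff]
    intro s w hw0 hwp i hi
    -- By `haff`, `c` is an affine function of the points that isolates `i` within `T`; applied to
    -- the affine dependence it gives `w i = 0`.
    obtain ⟨c, hc, hcT⟩ := hx.exists_relation (S := T) (by omega)
      (fun v => if v = i then 1 else 0)
    obtain ⟨α, β, hαβ⟩ := haff c hc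
    have hcoord : ∀ k, ∑ j ∈ s, w j * p j k = 0 := fun k => by
      have := congrArg (fun z : EuclideanSpace ℝ (Fin r) => z k) hwp
      simpa using this
    have h1 : ∑ j ∈ s, w j * c j = 0 := by
      simp only [hαβ, mul_add, Finset.sum_add_distrib, ← Finset.sum_mul, hw0, zero_mul, zero_add,
        Finset.mul_sum]
      rw [Finset.sum_comm]
      refine Finset.sum_eq_zero fun k _ => ?_
      rw [← mul_zero (β k), ← hcoord k, Finset.mul_sum]
      exact Finset.sum_congr rfl fun j _ => by ring
    rw [Finset.sum_eq_single i] at h1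
    · simpa [hcT i i.2] using h1
    · intro j _ hj
      rw [hcT j j.2, if_neg (fun h => hj (Subtype.ext h)), mul_zero]
    · exact fun h => absurd hi h
  refine ⟨p, hP1, ?_, hgen⟩
  have h1 := (hgen S hS).affineSpan_eq_top_iff_card_eq_finrank_add_one.2 (by simp [hS])
  unfold BarFramework.IsFullDimensional
  rw [eq_top_iff, ← h1]
  apply affineSpan_mono
  rintro _ ⟨i, rfl⟩
  exact ⟨i, rfl⟩

end

/-! ### Stress energy and universal rigidity -/

section

variable {V : Type*} [Fintype V] {d e : ℕ}

lemma norm_sub_sq_eq (a b : EuclideanSpace ℝ (Fin e)) :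
    ‖a - b‖ ^ 2 = ‖a‖ ^ 2 + ‖b‖ ^ 2 - 2 * ∑ k, a k * b k := by
  rw [norm_sub_sq_real, PiLp.inner_apply]
  simp only [RCLike.inner_apply, conj_trivial]
  rw [Finset.sum_congr rfl fun k _ => mul_comm (b k) (a k)]
  ring

/-- The energy of a configuration with respect to the Gram matrix of vectors summing to zero. -/
lemma sum_gram_mul_norm_sub_sq {x : V → Fin d → ℝ} (hsum : ∑ v, x v = 0)
    (q : V → EuclideanSpace ℝ (Fin e)) :
    ∑ u, ∑ v, (x u ⬝ᵥ x v) * ‖q u - q v‖ ^ 2 =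
      -2 * ∑ k, (∑ v, q v k • x v) ⬝ᵥ (∑ v, q v k • x v) := by
  have h1 : ∀ u, ∑ v, x u ⬝ᵥ x v = 0 := fun u => by
    rw [← dotProduct_sum, hsum, dotProduct_zero]
  have h2 : ∀ v, ∑ u, x u ⬝ᵥ x v = 0 := fun v => by
    rw [← sum_dotProduct, hsum, zero_dotProduct]
  have h3 : ∑ u, ∑ v, (x u ⬝ᵥ x v) * ‖q u‖ ^ 2 = 0 := by
    simp only [← Finset.sum_mul, h1, zero_mul, Finset.sum_const_zero]
  have h4 : ∑ u, ∑ v, (x u ⬝ᵥ x v) * ‖q v‖ ^ 2 = 0 := by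
    rw [Finset.sum_comm]
    simp only [← Finset.sum_mul, h2, zero_mul, Finset.sum_const_zero]
  have h5 : ∑ k, (∑ v, q v k • x v) ⬝ᵥ (∑ v, q v k • x v) =
      ∑ u, ∑ v, (x u ⬝ᵥ x v) * ∑ k, q u k * q v k := by
    simp only [sum_dotProduct, dotProduct_sum, smul_dotProduct, dotProduct_smul, smul_eq_mul]
    rw [Finset.sum_comm]
    refine Finset.sum_congr rfl fun u _ => ?_
    simp only [Finset.mul_sum]
    rw [Finset.sum_comm]
    refine Finset.sum_congr rfl fun v _ => ?_
    exact Finset.sum_congr rfl fun k _ => by rw [dotProduct_comm]; ring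
  rw [h5]
  simp only [norm_sub_sq_eq, mul_sub, mul_add, Finset.sum_sub_distrib, Finset.sum_add_distrib,
    h3, h4]
  simp only [Finset.mul_sum, zero_add, zero_sub, ← Finset.sum_neg_distrib]
  refine Finset.sum_congr rfl fun u _ => Finset.sum_congr rfl fun v _ =>
    Finset.sum_congr rfl fun k _ => by ring

/-- The point of the formula is that its right side does not depend on `w`. -/
lemma sum_norm_sub_sq_smul {x : V → Fin d → ℝ} (hsum : ∑ v, x v = 0)
    {q : V → EuclideanSpace ℝ (Fin e)} (hq : ∀ k, ∑ v, q v k • x v = 0) (w : V) :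
    ∑ v, ‖q w - q v‖ ^ 2 • x v = ∑ v, ‖q v‖ ^ 2 • x v := by
  have h : ∑ v, (2 * ∑ k, q w k * q v k) • x v = 0 := by
    simp only [Finset.mul_sum, Finset.sum_smul]
    rw [Finset.sum_comm]
    refine Finset.sum_eq_zero fun k _ => ?_
    simp only [mul_smul, ← Finset.smul_sum, hq, smul_zero]
  simp only [norm_sub_sq_eq, sub_smul, add_smul, Finset.sum_sub_distrib, Finset.sum_add_distrib, h,
    ← Finset.smul_sum, hsum, smul_zero, zero_add, sub_zero]

lemma congruent_of_equivalent [DecidableEq V] {r : ℕ} {G : SimpleGraph V}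
    (hG : LargeSetsConnected G d) (hd : 0 < d) (hdV : d ≤ Fintype.card V)
    {x : V → Fin d → ℝ} (hx : IsOrthRep G Finset.univ x)
    (hxP : GenPos Finset.univ x) (hsum : ∑ v, x v = 0) {p : V → EuclideanSpace ℝ (Fin r)}
    (hp : ∀ k, ∑ v, p v k • x v = 0) {q : V → EuclideanSpace ℝ (Fin e)}
    (hq : BarFramework.Equivalent G p q) : BarFramework.Congruent p q := by
  have horth : ∀ u v, x u ⬝ᵥ x v = 0 ∨ ‖q u - q v‖ ^ 2 = ‖p u - p v‖ ^ 2 := by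
    intro u v
    by_cases huv : u = v
    · subst huv
      right
      simp
    · by_cases hadj : G.Adj u v
      · exact Or.inr (hq u v hadj)
      · exact Or.inl (hx u (Finset.mem_univ u) v (Finset.mem_univ v) huv hadj)
  have henergy : ∑ u, ∑ v, (x u ⬝ᵥ x v) * ‖q u - q v‖ ^ 2 =
      ∑ u, ∑ v, (x u ⬝ᵥ x v) * ‖p u - p v‖ ^ 2 := by
    refine Finset.sum_congr rfl fun u _ => Finset.sum_congr rfl fun v _ => ?_
    rcases horth u v with h | h <;> rw [h]
    simp
  have hqK : ∀ k, ∑ v, q v k • x v = 0 := by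
    rw [sum_gram_mul_norm_sub_sq hsum, sum_gram_mul_norm_sub_sq hsum] at henergy
    simp only [hp, dotProduct_zero, Finset.sum_const_zero, mul_zero] at henergy
    have h0 := (mul_eq_zero.1 henergy).resolve_left (by norm_num)
    have hnonneg : ∀ z : Fin d → ℝ, 0 ≤ z ⬝ᵥ z := fun z =>
      Finset.sum_nonneg fun i _ => mul_self_nonneg (z i)
    rw [Finset.sum_eq_zero_iff_of_nonneg fun k _ => hnonneg _] at h0
    exact fun k => dotProduct_self_eq_zero.1 (h0 k (Finset.mem_univ k))
  set y := ∑ v, ‖q v‖ ^ 2 • x v - ∑ v, ‖p v‖ ^ 2 • x v with hy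
  have hD : ∀ w, ∑ v, (‖q w - q v‖ ^ 2 - ‖p w - p v‖ ^ 2) • x v = y := fun w => by
    simp only [sub_smul, Finset.sum_sub_distrib]
    rw [sum_norm_sub_sq_smul hsum hqK, sum_norm_sub_sq_smul hsum hp]
  -- Termwise: the length difference vanishes on edges and the diagonal, the inner product on
  -- nonedges.
  have hyx : ∀ w, y ⬝ᵥ x w = 0 := fun w => by
    rw [← hD w, sum_dotProduct]
    refine Finset.sum_eq_zero fun v _ => ?_
    rw [smul_dotProduct, dotProduct_comm, smul_eq_mul, mul_eq_zero, sub_eq_zero]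
    exact (horth w v).symm
  have hy0 : y = 0 := by
    have hall : ∀ z ∈ Submodule.span ℝ (Set.range x), y ⬝ᵥ z = 0 := by
      intro z hz
      induction hz using Submodule.span_induction with
      | mem z hz =>
        obtain ⟨w, rfl⟩ := hz
        exact hyx w
      | zero => simp
      | add a b _ _ ha hb => rw [dotProduct_add, ha, hb, add_zero]
      | smul t a _ ha => rw [dotProduct_smul, ha, smul_zero]
    rw [hxP.span_eq_top hdV] at hall
    exact dotProduct_self_eq_zero.1 (hall y Submodule.mem_top)
  intro w v
  have h := hxP.eq_zero_of_sum_smul_eq_zero ((hD w).trans hy0) (S := (nonNbrs G Finset.univ w)ᶜ)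
    (by
      have := card_nonNbrs_lt hG hd Finset.univ w
      rw [Finset.card_compl]
      omega)
    (by
      intro u hu
      rw [Finset.mem_compl, mem_nonNbrs] at hu
      by_cases huw : u = w
      · simp [huw]
      · rw [hq w u (by by_contra hadj; exact hu ⟨Finset.mem_univ u, huw, hadj⟩), sub_self])
  exact sub_eq_zero.1 (congrFun h v)

end

end OrthRep

theorem theorem1p1 {V : Type*} [Fintype V] (G : SimpleGraph V) (n r : ℕ)
    (hn : Fintype.card V = n) (hr : 1 ≤ r) (hrn : r + 2 ≤ n)
    (hG : BarFramework.IsVertexConnected G (r + 1)) :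
    ∃ p : V → EuclideanSpace ℝ (Fin r),
      BarFramework.IsFullDimensional p ∧ BarFramework.InGeneralPosition p ∧
        BarFramework.UniversallyRigid G p := by
  classical
  obtain ⟨d, hd⟩ : ∃ d, d + r + 1 = Fintype.card V := ⟨n - (r + 1), by omega⟩
  have hd0 : 0 < d := by omega
  have hconn := OrthRep.largeSetsConnected_of_isVertexConnected hd hG
  obtain ⟨x, hx, hxP, hsum⟩ := OrthRep.exists_genPos_sum_eq_zero hconn hd0 (by omega)
  obtain ⟨p, hp, hfull, hgen⟩ := hxP.exists_gale hsum hd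
  refine ⟨p, hfull, hgen, ?_⟩
  rintro ⟨e, -, -, q, -, hq, hncong⟩
  exact hncong (OrthRep.congruent_of_equivalent hconn hd0 (by omega) hx hxP hsum hp hq)
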